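/- Let $H$ be an infinite-dimensional separable complex Hilbert space, and let $\mathrm{SA}(H)$ be the set of all (not necessarily bounded) self-adjoint operators on $H$, equipped with the strong resolvent topology (SRT), i.e. the coarsest topology for which the map $A\mapsto (A-i)^{-1}\in\mathbb{B}(H)$ is continuous with respect to the strong operator topology on $\mathbb{B}(H)$. For $A\in\mathrm{SA}(H)$ let $\sigma_{\mathrm p}(A)$ be the set of eigenvalues of $A$, and let $\sigma_{\mathrm{ac}}(A)$ be the absolutely continuous spectrum of $A$, i.e. the spectrum of the part of $A$ in the closed subspace $H_{\mathrm{ac}}(A)$ of all $\xi\in H$ whose spectral measure is absolutely continuous with respect to Lebesgue measure; in particular, $\sigma_{\mathrm{ac}}(A)=\emptyset$ if and only if $H_{\mathrm{ac}}(A)=\{0\}$. Here the spectral measure of $A$ at $\xi$ is the unique finite Borel measure $\mu_\xi$ on $\mathbb{R}$ such that $\langle \xi,(A-z)^{-1}\xi\rangle=\int_{\mathbb{R}}\frac{d\mu_\xi(t)}{t-z}$ for all $z\in\mathbb{C}\setminus\mathbb{R}$ (the inner product being linear in its second argument). Then the set $$\{A\in \mathrm{SA}(H)\;;\;\sigma_{\mathrm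 p}(A)=\sigma_{\mathrm{ac}}(A)=\emptyset\}$$ is dense in $\mathrm{SA}(H)$. -/

import Mathlib

open MeasureTheory
open scoped Topology InnerProductSpace

/-- The set `SA(H)` of all (not necessarily bounded) self-adjoint operators on `H`: partially
defined linear operators that coincide with their adjoint, domains included
(such an operator is automatically densely defined, see `IsSelfAdjoint.dense_domain`). -/
structure SA (H : Type*) [NormedAddCommGroup H] [InnerProductSpace ℂ H] [CompleteSpace H] where
  /-- the underlying partially defined linear operator -/
  op : H →ₗ.[ℂ] H
  selfAdjoint : IsSelfAdjoint op

namespace SA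

variable {H : Type*} [NormedAddCommGroup H] [InnerProductSpace ℂ H] [CompleteSpace H]

/-- The operator `A - z`, as a linear map from `dom A` to `H`. -/
def shift (A : SA H) (z : ℂ) : A.op.domain →ₗ[ℂ] H :=
  A.op.toFun - z • A.op.domain.subtype

theorem shift_apply (A : SA H) (z : ℂ) (x : A.op.domain) :
    A.shift z x = A.op x - z • (x : H) := rfl

theorem isFormalAdjoint (A : SA H) (x y : A.op.domain) :
    ⟪A.op x, (y : H)⟫_ℂ = ⟪(x : H), A.op y⟫_ℂ := by
  have h := LinearPMap.adjoint_isFormalAdjoint A.selfAdjoint.dense_domain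
  rw [LinearPMap.isSelfAdjoint_def.mp A.selfAdjoint] at h
  exact h x y

theorem inner_op_self_im (A : SA H) (x : A.op.domain) : (⟪(x : H), A.op x⟫_ℂ).im = 0 := by
  apply Complex.conj_eq_iff_im.mp
  rw [inner_conj_symm, A.isFormalAdjoint]

theorem le_norm_shift (A : SA H) (z : ℂ) (x : A.op.domain) :
    |z.im| * ‖(x : H)‖ ≤ ‖A.shift z x‖ := by
  rcases eq_or_ne (x : H) 0 with h0 | h0
  · simp [h0]
  have hpos : 0 < ‖(x : H)‖ := norm_pos_iff.mpr h0
  have him : (⟪(x : H), A.shift z x⟫_ℂ).im = -(z.im * ‖(x : H)‖ ^ 2) := by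
    rw [shift_apply, inner_sub_right, inner_smul_right, Complex.sub_im, A.inner_op_self_im,
      inner_self_eq_norm_sq_to_K]
    have : ((‖(x : H)‖ : ℂ) ^ 2) = ((‖(x : H)‖ ^ 2 : ℝ) : ℂ) := by push_cast; rfl
    erw [this, Complex.im_mul_ofReal]
    ring
  have h1 : |z.im| * ‖(x : H)‖ ^ 2 ≤ ‖(x : H)‖ * ‖A.shift z x‖ := by
    calc |z.im| * ‖(x : H)‖ ^ 2 = |(⟪(x : H), A.shift z x⟫_ℂ).im| := by
          rw [him, abs_neg, abs_mul, abs_of_nonneg (sq_nonneg ‖(x : H)‖)]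
      _ ≤ ‖⟪(x : H), A.shift z x⟫_ℂ‖ := Complex.abs_im_le_norm _
      _ ≤ _ := norm_inner_le_norm _ _
  nlinarith

theorem shift_injective (A : SA H) {z : ℂ} (hz : z.im ≠ 0) : Function.Injective (A.shift z) := by
  rw [← LinearMap.ker_eq_bot, LinearMap.ker_eq_bot']
  intro x hx
  have h := A.le_norm_shift z x
  rw [hx, norm_zero] at h
  have h2 : ‖(x : H)‖ ≤ 0 := by
    by_contra hc
    push Not at hc
    have := mul_pos (abs_pos.mpr hz) hc
    linarith
  exact Subtype.ext (norm_le_zero_iff.mp h2)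

theorem isClosed_range_shift (A : SA H) {z : ℂ} (hz : z.im ≠ 0) :
    IsClosed (LinearMap.range (A.shift z) : Set H) := by
  have hcl : IsClosed (A.op.graph : Set (H × H)) := A.selfAdjoint.isClosed
  have hz' : 0 < |z.im| := abs_pos.mpr hz
  refine isClosed_of_closure_subset fun y hy => ?_
  obtain ⟨u, hu, hlim⟩ := mem_closure_iff_seq_limit.mp hy
  choose x hx using hu
  have hcau : CauchySeq fun n => ((x n : A.op.domain) : H) := by
    rw [Metric.cauchySeq_iff']
    intro ε hε
    obtain ⟨N, hN⟩ := Metric.cauchySeq_iff'.mp hlim.cauchySeq (|z.im| * ε) (by positivity)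
    refine ⟨N, fun n hn => ?_⟩
    have h1 := A.le_norm_shift z (x n - x N)
    rw [map_sub, hx, hx] at h1
    have h2 := hN n hn
    rw [dist_eq_norm] at h2 ⊢
    rw [Submodule.coe_sub] at h1
    exact lt_of_mul_lt_mul_left (h1.trans_lt h2) hz'.le
  obtain ⟨x₀, hx₀⟩ := cauchySeq_tendsto_of_complete hcau
  have hA : Filter.Tendsto (fun n => A.op (x n)) Filter.atTop (𝓝 (y + z • x₀)) := by
    have : (fun n => A.op (x n)) = fun n => u n + z • ((x n : A.op.domain) : H) := by
      funext n
      rw [← hx n, shift_apply, sub_add_cancel]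
    rw [this]
    exact hlim.add (hx₀.const_smul z)
  have hmem : (x₀, y + z • x₀) ∈ A.op.graph :=
    hcl.mem_of_tendsto (hx₀.prodMk_nhds hA)
      (Filter.Eventually.of_forall fun n => A.op.mem_graph (x n))
  obtain ⟨w, hw1, hw2⟩ := (LinearPMap.mem_graph_iff A.op).mp hmem
  refine ⟨w, ?_⟩
  simp only at hw1 hw2
  rw [shift_apply, hw1, hw2, add_sub_cancel_right]

theorem shift_surjective (A : SA H) {z : ℂ} (hz : z.im ≠ 0) :
    Function.Surjective (A.shift z) := by
  rw [← LinearMap.range_eq_top]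
  have : CompleteSpace (LinearMap.range (A.shift z)) :=
    (A.isClosed_range_shift hz).completeSpace_coe
  rw [← Submodule.orthogonal_eq_bot_iff, Submodule.eq_bot_iff]
  intro y hy
  have horth : ∀ x : A.op.domain, ⟪(starRingEnd ℂ z) • y, (x : H)⟫_ℂ = ⟪y, A.op x⟫_ℂ := by
    intro x
    have h : ⟪y, A.shift z x⟫_ℂ = 0 :=
      (Submodule.mem_orthogonal' _ y).mp hy _ ⟨x, rfl⟩
    rw [shift_apply, inner_sub_right, inner_smul_right, sub_eq_zero] at h
    rw [inner_smul_left, Complex.conj_conj, h]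
  have hadj := LinearPMap.isSelfAdjoint_def.mp A.selfAdjoint
  have hy1 := LinearPMap.mem_adjoint_domain_of_exists (T := A.op) y ⟨_, horth⟩
  have hy2 := LinearPMap.adjoint_apply_eq A.selfAdjoint.dense_domain ⟨y, hy1⟩ horth
  have hy1' : y ∈ A.op.domain := by rw [← hadj]; exact hy1
  have hy3 : A.op ⟨y, hy1'⟩ = (starRingEnd ℂ z) • y :=
    ((le_of_eq hadj).2 (x := ⟨y, hy1⟩) (y := ⟨y, hy1'⟩) rfl).symm.trans hy2
  have h0 : A.shift (starRingEnd ℂ z) ⟨y, hy1'⟩ = 0 := by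
    rw [shift_apply, hy3, sub_self]
  have hz' : (starRingEnd ℂ z).im ≠ 0 := by simpa using hz
  have := A.shift_injective hz' (h0.trans (map_zero _).symm)
  simpa using congrArg Subtype.val this

/-- The resolvent `(A - z)⁻¹`, a bounded operator on `H`, at a non-real number `z`. -/
noncomputable def resolvent (A : SA H) (z : ℂ) (hz : z.im ≠ 0) : H →L[ℂ] H :=
  (A.op.domain.subtype ∘ₗ
      (LinearEquiv.ofBijective (A.shift z)
        ⟨A.shift_injective hz, A.shift_surjective hz⟩).symm.toLinearMap).mkContinuous |z.im|⁻¹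
    (fun y => by
      obtain ⟨x, rfl⟩ := A.shift_surjective hz y
      have hx : (LinearEquiv.ofBijective (A.shift z)
          ⟨A.shift_injective hz, A.shift_surjective hz⟩).symm (A.shift z x) = x :=
        LinearEquiv.ofBijective_symm_apply_apply _ x
      rw [LinearMap.comp_apply, LinearEquiv.coe_coe, hx, inv_mul_eq_div,
        le_div_iff₀ (abs_pos.mpr hz), mul_comm]
      exact A.le_norm_shift z x)

theorem resolvent_shift (A : SA H) (z : ℂ) (hz : z.im ≠ 0) (x : A.op.domain) :
    A.resolvent z hz (A.shift z x) = x :=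
  congrArg Subtype.val (LinearEquiv.ofBijective_symm_apply_apply
    (f := A.shift z) (h := ⟨A.shift_injective hz, A.shift_surjective hz⟩) x)

theorem shift_resolvent (A : SA H) (z : ℂ) (hz : z.im ≠ 0) (y : H) :
    ∃ h : A.resolvent z hz y ∈ A.op.domain, A.shift z ⟨A.resolvent z hz y, h⟩ = y := by
  obtain ⟨x, rfl⟩ := A.shift_surjective hz y
  have hx := A.resolvent_shift z hz x
  refine ⟨by rw [hx]; exact x.2, ?_⟩
  congr 1
  exact Subtype.ext hx

/-- The strong resolvent topology on `SA(H)`: the coarsest topology that makes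
`A ↦ (A - i)⁻¹` continuous for the strong operator topology on the bounded operators, that is,
the topology of pointwise convergence. -/
noncomputable instance strongResolventTopology : TopologicalSpace (SA H) :=
  TopologicalSpace.induced
    (fun A => ContinuousLinearMap.toPointwiseConvergenceCLM ℂ (RingHom.id ℂ) H H
      (A.resolvent Complex.I (by simp)))
    inferInstance

/-- The point spectrum `σ_p(A)`: the set of eigenvalues of `A`. -/
def pointSpectrum (A : SA H) : Set ℂ :=
  {z | ∃ x : A.op.domain, (x : H) ≠ 0 ∧ A.op x = z • (x : H)}

/-- `μ` is the (scalar) spectral measure `μ_ξ = ⟨ξ, E_A(·) ξ⟩` of `A` at the vector `ξ`: the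
finite Borel measure on `ℝ` (it exists and is unique) with
`⟨ξ, (A - z)⁻¹ ξ⟩ = ∫ (t - z)⁻¹ dμ(t)` for all non-real `z`. -/
def IsSpectralMeasure (A : SA H) (ξ : H) (μ : Measure ℝ) : Prop :=
  IsFiniteMeasure μ ∧
    ∀ (z : ℂ) (hz : z.im ≠ 0), ⟪ξ, A.resolvent z hz ξ⟫_ℂ = ∫ t : ℝ, ((t : ℂ) - z)⁻¹ ∂μ

/-- The absolutely continuous subspace `H_ac(A)`: the vectors whose spectral measure is
absolutely continuous with respect to Lebesgue measure. (As each vector has exactly one spectral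
measure, "for all" could as well read "there is".) -/
def acSubspace (A : SA H) : Set H :=
  {ξ | ∀ μ : Measure ℝ, A.IsSpectralMeasure ξ μ → μ ≪ volume}

/-- The absolutely continuous spectrum `σ_ac(A)`: the spectrum of the part of `A` in `H_ac(A)`,
the closed operator in `H_ac(A)` that is `A` with domain `dom A ∩ H_ac(A)`. Its resolvent set
consists of the `z` such that `A - z` maps `dom A ∩ H_ac(A)` bijectively onto `H_ac(A)`
(the inverse is then bounded by the closed graph theorem). In particular, `σ_ac(A)` is empty
exactly if `H_ac(A) = {0}`. -/
def acSpectrum (A : SA H) : Set ℂ :=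
  {z | ¬ Set.BijOn (A.shift z) {x | (x : H) ∈ A.acSubspace} A.acSubspace}

end SA

/-! A basic strong resolvent neighbourhood of `A` tests `R = (A - i)⁻¹` on finitely many vectors `ξ`
only. Let `V` be the span of these `ξ` and the `R ξ`. As `A R ξ = ξ + i R ξ` lies in `V`,
compressing `A` to `V` loses nothing on the `R ξ`, and the compression extends to a symmetric `L` on
`V` with `(L - i) R ξ = ξ` (`exists_finiteDimensional_isSymmetric`). So `A` may be replaced by a
Hermitian matrix, without the spectral theorem for unbounded operators.

Diagonalise `L` and let a unitary from `H` to `L²(ℝ)` carry its eigenvectors to indicators of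
intervals `[k, k + 1)`; then `L` becomes multiplication by a step function. Add to that function `ε
c`, where `c` is injective and measurable with values in a Lebesgue null subset of `[0, 1]`. The sum
has countable level sets, so multiplication by it has no eigenvalues; its range is null, so every
spectral measure is singular. This moves the operator by at most `ε` on `V`
(`exists_singularContinuous_approx`), and the second resolvent identity carries the bound over to
the resolvents. -/

/-! ### Bounded operators in `SA H` and a density criterion -/

namespace SA

variable {H : Type*} [NormedAddCommGroup H] [InnerProductSpace ℂ H] [CompleteSpace H]

/-- A bounded self-adjoint operator, as an element of `SA H`. -/
noncomputable def ofBounded (T : H →L[ℂ] H) (hT : IsSelfAdjoint T) : SA H where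
  op := (T : H →ₗ[ℂ] H).toPMap ⊤
  selfAdjoint := by
    rw [LinearPMap.isSelfAdjoint_def,
      ContinuousLinearMap.toPMap_adjoint_eq_adjoint_toPMap_of_dense _ (by simp),
      ContinuousLinearMap.isSelfAdjoint_iff'.mp hT]

theorem shift_ofBounded (T : H →L[ℂ] H) (hT : IsSelfAdjoint T) (z : ℂ)
    (x : (ofBounded T hT).op.domain) :
    (ofBounded T hT).shift z x = T x - z • (x : H) := rfl

theorem resolvent_ofBounded (T : H →L[ℂ] H) (hT : IsSelfAdjoint T) {z : ℂ} (hz : z.im ≠ 0)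
    (x : H) : (ofBounded T hT).resolvent z hz (T x - z • x) = x :=
  (ofBounded T hT).resolvent_shift z hz ⟨x, Submodule.mem_top⟩

theorem norm_resolvent_le (A : SA H) {z : ℂ} (hz : z.im ≠ 0) (y : H) :
    ‖A.resolvent z hz y‖ ≤ |z.im|⁻¹ * ‖y‖ := by
  obtain ⟨h, hy⟩ := A.shift_resolvent z hz y
  have := A.le_norm_shift z ⟨_, h⟩
  rw [hy] at this
  rwa [inv_mul_eq_div, le_div_iff₀ (abs_pos.mpr hz), mul_comm]

/-- To approximate `A` in the strong resolvent topology it suffices to approximate its resolvent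
at `i` on finitely many vectors. -/
theorem mem_closure_of_resolvent_approx (A : SA H) (s : Set (SA H))
    (h : ∀ (F : Finset H) (ε : ℝ), 0 < ε → ∃ B ∈ s, ∀ ξ ∈ F,
      ‖B.resolvent Complex.I (by simp) ξ - A.resolvent Complex.I (by simp) ξ‖ < ε) :
    A ∈ closure s := by
  have hi : Topology.IsInducing
      (fun B : SA H => (fun ξ : H => B.resolvent Complex.I (by simp) ξ)) :=
    (PointwiseConvergenceCLM.isEmbedding_coeFn (RingHom.id ℂ) H H).isInducing.comp ⟨rfl⟩
  -- The topology is induced from the product `H → H`, whose basic neighbourhoods restrict finitely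
  -- many coordinates.
  rw [hi.closure_eq_preimage_closure_image, Set.mem_preimage, mem_closure_iff_nhds_basis
    (by rw [nhds_pi]; exact Filter.hasBasis_pi fun _ => Metric.nhds_basis_ball)]
  rintro ⟨I, r⟩ ⟨hI, hr⟩
  obtain ⟨ε, hε, hεr⟩ : ∃ ε > 0, ∀ i ∈ I, ε ≤ r i := by
    rcases I.eq_empty_or_nonempty with rfl | hne
    · exact ⟨1, one_pos, by simp⟩
    · obtain ⟨i, hi, hmin⟩ := Set.exists_min_image I r hI hne
      exact ⟨r i, hr i hi, hmin⟩
  obtain ⟨B, hB, hBF⟩ := h hI.toFinset ε hε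
  refine ⟨_, ⟨B, hB, rfl⟩, fun ξ hξ => ?_⟩
  rw [Metric.mem_ball, dist_eq_norm]
  exact (hBF ξ (by simpa using hξ)).trans_le (hεr ξ hξ)

theorem acSpectrum_eq_empty_of_subset (A : SA H) (h : A.acSubspace ⊆ {0}) :
    A.acSpectrum = ∅ := by
  refine Set.eq_empty_of_forall_notMem fun z hz => hz ⟨?_, ?_, ?_⟩
  · intro x hx
    have hx0 : x = 0 := Subtype.ext (h hx)
    subst hx0
    rw [map_zero]
    exact hx
  · intro x hx y hy _
    exact Subtype.ext ((h hx).trans (h hy).symm)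
  · intro y hy
    obtain rfl : y = 0 := h hy
    exact ⟨0, hy, map_zero _⟩

end SA

/-! ### Symmetric extension in finite dimension -/

/-- A symmetric operator on a subspace of a finite-dimensional inner product space extends to a
symmetric operator on the whole space. -/
theorem Submodule.exists_isSymmetric_extension {V : Type*} [NormedAddCommGroup V]
    [InnerProductSpace ℂ V] [FiniteDimensional ℂ V] (D : Submodule ℂ V) (T : D →ₗ[ℂ] V)
    (hT : ∀ x y : D, ⟪T x, (y : V)⟫_ℂ = ⟪(x : V), T y⟫_ℂ) :
    ∃ L : V →ₗ[ℂ] V, L.IsSymmetric ∧ ∀ x : D, L x = T x := by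
  let p : V →ₗ[ℂ] D := D.orthogonalProjectionOnto.toLinearMap
  have hp : ∀ x y : V, ⟪(p x : V), y⟫_ℂ = ⟪x, (p y : V)⟫_ℂ := fun x y =>
    D.inner_starProjection_left_eq_right x y
  have hpD : ∀ x : D, p x = x := fun x => D.orthogonalProjectionOnto_mem_subspace_eq_self x
  let S : V →ₗ[ℂ] V := T ∘ₗ p
  have hS : ∀ x y : V, ⟪S x, (p y : V)⟫_ℂ = ⟪(p x : V), S y⟫_ℂ := fun x y => hT _ _
  -- With respect to `D ⊕ Dᗮ`, `S` has block rows `(a, 0), (b, 0)` with `a` symmetric; this operator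
  -- has rows `(a, b*), (b, 0)`.
  refine ⟨S + LinearMap.adjoint S - D.subtype ∘ₗ p ∘ₗ S, fun x y => ?_, fun x => ?_⟩
  · simp only [LinearMap.sub_apply, LinearMap.add_apply, LinearMap.comp_apply, inner_sub_left,
      inner_sub_right, inner_add_left, inner_add_right, LinearMap.adjoint_inner_left,
      LinearMap.adjoint_inner_right, Submodule.subtype_apply]
    rw [hp (S x) y, hS x y, ← hp x (S y)]
    ring
  · have h1 : LinearMap.adjoint S (x : V) = (p (S x) : V) := by
      refine ext_inner_left ℂ fun y => ?_
      rw [LinearMap.adjoint_inner_right, ← hp, ← hS, hpD]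
    simp only [LinearMap.sub_apply, LinearMap.add_apply, LinearMap.comp_apply, h1,
      Submodule.subtype_apply, add_sub_cancel_right, S, hpD]

/-! ### Null sets and the singular step function -/

/-- There is a bounded uncountable Borel set of real numbers that is Lebesgue null: the Liouville
numbers of the unit interval. -/
theorem exists_null_measurableSet_not_countable :
    ∃ N : Set ℝ, MeasurableSet N ∧ N ⊆ Set.Icc 0 1 ∧ volume N = 0 ∧ ¬ N.Countable := by
  refine ⟨{x | Liouville x} ∩ Set.Icc 0 1,
    IsGδ.setOfPred_liouville.measurableSet.inter measurableSet_Icc, Set.inter_subset_right,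
    measure_mono_null Set.inter_subset_left volume_setOfPred_liouville, fun hc => ?_⟩
  -- Baire category: a countable set has residual complement, yet the Liouville numbers are residual
  -- too, so the two meet inside `(0, 1)`.
  have h1 : ({x | Liouville x} ∩ Set.Icc (0 : ℝ) 1)ᶜ ∈ residual ℝ := by
    rw [← Set.biUnion_of_singleton ({x | Liouville x} ∩ Set.Icc (0 : ℝ) 1), Set.compl_iUnion₂]
    refine (countable_bInter_mem hc).mpr fun x _ => ?_
    exact residual_of_dense_open isOpen_compl_singleton (dense_compl_singleton x)
  have h2 := dense_of_mem_residual (Filter.inter_mem h1 eventually_residual_liouville)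
  obtain ⟨x, hx, hx1, hx2⟩ := h2.inter_open_nonempty (Set.Ioo 0 1) isOpen_Ioo (by simp)
  exact hx1 ⟨hx2, Set.Ioo_subset_Icc_self hx⟩

/-- There is an injective measurable function from `ℝ` to the unit interval with Lebesgue null
range. -/
theorem exists_measurable_injective_null_range :
    ∃ c : ℝ → ℝ, Measurable c ∧ Function.Injective c ∧ (∀ x, c x ∈ Set.Icc (0 : ℝ) 1) ∧
      ∃ N : Set ℝ, MeasurableSet N ∧ volume N = 0 ∧ ∀ x, c x ∈ N := by
  obtain ⟨N, hN, hN1, hN0, hNc⟩ := exists_null_measurableSet_not_countable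
  have : StandardBorelSpace N := hN.standardBorel
  -- Uncountable standard Borel spaces are Borel isomorphic.
  let e : ℝ ≃ᵐ N := PolishSpace.measurableEquivOfNotCountable
    (fun h => Cardinal.not_countable_real (Set.countable_univ_iff.mpr h))
    (fun h => hNc (Set.countable_coe_iff.mp h))
  exact ⟨fun x => e x, measurable_subtype_coe.comp e.measurable,
    Subtype.val_injective.comp e.injective, fun x => hN1 (e x).2, N, hN, hN0, fun x => (e x).2⟩

/-- A small perturbation of the step function with values `l 0`, `l 1`, ... that takes each value
countably often and has Lebesgue null range. -/
theorem exists_singular_step_function (l : ℕ → ℝ) {ε : ℝ} (hε : 0 < ε) :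
    ∃ f : ℝ → ℝ, Measurable f ∧ (∀ x, |f x - l ⌊x⌋₊| ≤ ε) ∧ (∀ t, (f ⁻¹' {t}).Countable) ∧
      ∃ N : Set ℝ, MeasurableSet N ∧ volume N = 0 ∧ ∀ x, f x ∈ N := by
  obtain ⟨c, hc, hcinj, hc01, N, hN, hN0, hcN⟩ := exists_measurable_injective_null_range
  have hmeas : ∀ k : ℕ, Measurable fun t : ℝ => (t - l k) / ε := fun k => by fun_prop
  -- Each level set has at most one point per value of `k`. On negative `x` the floor is `0`, which
  -- does no harm.
  refine ⟨fun x => l ⌊x⌋₊ + ε * c x, ?_, fun x => ?_, fun t => ?_,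
    ⋃ k : ℕ, (fun t => (t - l k) / ε) ⁻¹' N, .iUnion fun k => hmeas k hN, ?_, fun x => ?_⟩
  · exact ((measurable_from_top (f := l)).comp Nat.measurable_floor).add (hc.const_mul ε)
  · rw [add_sub_cancel_left, abs_mul, abs_of_pos hε, abs_of_nonneg (hc01 x).1]
    exact mul_le_of_le_one_right hε.le (hc01 x).2
  · refine Set.Countable.mono (s₂ := ⋃ k : ℕ, c ⁻¹' {(t - l k) / ε}) (fun x hx => ?_)
      (Set.countable_iUnion fun k =>
        (Set.subsingleton_singleton.preimage hcinj).countable)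
    rw [Set.mem_iUnion]
    refine ⟨⌊x⌋₊, ?_⟩
    have hx' : l ⌊x⌋₊ + ε * c x = t := hx
    rw [Set.mem_preimage, Set.mem_singleton_iff, ← hx']
    field_simp
    ring
  · refine measure_iUnion_null fun k => ?_
    have : (fun t => (t - l k) / ε) ⁻¹' N = (fun t => t - l k) ⁻¹' ((fun t => t * ε⁻¹) ⁻¹' N) := rfl
    rw [this, (measurePreserving_sub_right volume (l k)).measure_preimage
      (measurable_mul_const ε⁻¹ hN).nullMeasurableSet, Real.volume_preimage_mul_right (inv_ne_zero hε.ne'), hN0,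
      mul_zero]
  · refine Set.mem_iUnion.mpr ⟨⌊x⌋₊, ?_⟩
    rw [Set.mem_preimage, add_sub_cancel_left, mul_div_cancel_left₀ _ hε.ne']
    exact hcN x

/-! ### Hilbert bases and a unitary with prescribed values -/

/-- A Hilbert basis of an infinite-dimensional space is infinite. -/
theorem HilbertBasis.infinite_index {ι E : Type*} [NormedAddCommGroup E] [InnerProductSpace ℂ E]
    (b : HilbertBasis ι ℂ E) (hE : ¬ FiniteDimensional ℂ E) : Infinite ι := by
  by_contra h
  have := not_infinite_iff_finite.mp h
  have := Fintype.ofFinite ι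
  exact hE (Module.Finite.of_basis b.toOrthonormalBasis.toBasis)

/-- Distinct members are at distance `√2`, so balls of radius `1/2` around them are disjoint and
open. -/
theorem Orthonormal.countable_of_separable {ι E : Type*} [NormedAddCommGroup E]
    [InnerProductSpace ℂ E] [TopologicalSpace.SeparableSpace E] {v : ι → E}
    (hv : Orthonormal ℂ v) : Countable ι := by
  have hd : Pairwise fun i j => Disjoint (Metric.ball (v i) (1 / 2)) (Metric.ball (v j) (1 / 2)) := by
    intro i j hij
    refine Metric.ball_disjoint_ball ?_
    have h2 : ‖v i - v j‖ ^ 2 = 2 := by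
      rw [@norm_sub_sq ℂ, hv.inner_eq_zero hij, hv.1 i, hv.1 j]
      norm_num
    rw [dist_eq_norm]
    nlinarith [norm_nonneg (v i - v j)]
  exact Set.countable_univ_iff.mp <| Set.PairwiseDisjoint.countable_of_isOpen
    (s := fun i => Metric.ball (v i) (1 / 2 : ℝ)) (fun i _ j _ hij => hd hij)
    (fun i _ => Metric.isOpen_ball) (fun i _ => ⟨v i, Metric.mem_ball_self (by norm_num)⟩)

/-- A finite orthonormal family in an infinite-dimensional separable Hilbert space can be moved by
a unitary to the beginning of any orthonormal sequence of any separable Hilbert space. -/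
theorem Orthonormal.exists_linearIsometryEquiv_apply_eq {E G : Type*}
    [NormedAddCommGroup E] [InnerProductSpace ℂ E] [CompleteSpace E]
    [TopologicalSpace.SeparableSpace E] (hE : ¬ FiniteDimensional ℂ E)
    [NormedAddCommGroup G] [InnerProductSpace ℂ G] [CompleteSpace G]
    [TopologicalSpace.SeparableSpace G] {n : ℕ} {e : Fin n → E} (he : Orthonormal ℂ e)
    {g : ℕ → G} (hg : Orthonormal ℂ g) :
    ∃ U : E ≃ₗᵢ[ℂ] G, ∀ k : Fin n, U (e k) = g k := by
  classical
  obtain ⟨w, b, hew, hb⟩ := he.toSubtypeRange.exists_hilbertBasis_extension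
  obtain ⟨w', b', hgw, hb'⟩ := hg.toSubtypeRange.exists_hilbertBasis_extension
  have hw : Infinite w := b.infinite_index hE
  have hwc : Countable w := b.orthonormal.countable_of_separable
  have hw' : Infinite w' := (Set.infinite_range_of_injective hg.linearIndependent.injective).mono hgw
    |>.to_subtype
  have hwc' : Countable w' := b'.orthonormal.countable_of_separable
  let i : Fin n → w := fun k => ⟨e k, hew ⟨k, rfl⟩⟩
  let j : Fin n → w' := fun k => ⟨g k, hgw ⟨k, rfl⟩⟩
  have hi : Function.Injective i := fun k m h =>
    he.linearIndependent.injective (congrArg Subtype.val h)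
  have hj : Function.Injective j := fun k m h =>
    Fin.val_injective (hg.linearIndependent.injective (congrArg Subtype.val h))
  let φ : Set.range i ↪ w' := (Equiv.ofInjective i hi).symm.toEmbedding.trans ⟨j, hj⟩
  -- Both index sets are countably infinite, so an injection defined on finitely many indices
  -- extends to a bijection.
  obtain ⟨σ, hσ⟩ := Cardinal.extend_function_of_lt φ
    ((Cardinal.lt_aleph0_of_finite _).trans_le (Cardinal.infinite_iff.mp hw))
    (nonempty_equiv_of_countable)
  have hσ' : ∀ k, σ (i k) = j k := fun k => by
    have := hσ ⟨i k, k, rfl⟩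
    rw [this]
    change j _ = j k
    congr 1
    exact Equiv.ofInjective_symm_apply hi k
  let b'' : HilbertBasis w ℂ G := HilbertBasis.mk (v := fun k => b' (σ k))
    (b'.orthonormal.comp σ σ.injective) (by
      have : Set.range (fun k => b' (σ k)) = Set.range b' := σ.surjective.range_comp b'
      rw [this, b'.dense_span])
  refine ⟨b.repr.trans b''.repr.symm, fun k => ?_⟩
  have h1 : e k = b (i k) := by rw [hb]
  have h2 : g k = b'' (i k) := by
    rw [HilbertBasis.coe_mk, hσ', hb']
  rw [h1, h2, LinearIsometryEquiv.trans_apply, b.repr_self, b''.repr_symm_single]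

/-! ### Multiplication operators on `L²` -/

namespace MeasureTheory.Lp

/-- Multiplication by an essentially bounded function, as a bounded operator on `L²`. -/
noncomputable def mulL {α : Type*} [MeasurableSpace α] {μ : Measure α} {f : α → ℂ}
    (hf : MemLp f ⊤ μ) : Lp ℂ 2 μ →L[ℂ] Lp ℂ 2 μ :=
  (ContinuousLinearMap.mul ℂ ℂ).holderL μ ⊤ 2 2 (hf.toLp f)

variable {α : Type*} [MeasurableSpace α] {μ : Measure α} {f : α → ℂ} (hf : MemLp f ⊤ μ)

theorem coeFn_mulL (g : Lp ℂ 2 μ) : mulL hf g =ᵐ[μ] fun x => f x * g x := by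
  have h1 := (ContinuousLinearMap.mul ℂ ℂ).coeFn_holder (r := 2) (hf.toLp f) g
  filter_upwards [h1, hf.coeFn_toLp] with x hx hx'
  rw [← hx']
  exact hx

theorem isSelfAdjoint_mulL {f : α → ℝ} (hf : MemLp (fun x => (f x : ℂ)) ⊤ μ) :
    IsSelfAdjoint (mulL hf) := by
  rw [ContinuousLinearMap.isSelfAdjoint_iff_isSymmetric]
  intro g h
  change ⟪mulL hf g, h⟫_ℂ = ⟪g, mulL hf h⟫_ℂ
  rw [L2.inner_def, L2.inner_def]
  refine integral_congr_ae ?_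
  filter_upwards [coeFn_mulL hf g, coeFn_mulL hf h] with x hx hx'
  rw [hx, hx']
  simp only [RCLike.inner_apply, map_mul, Complex.conj_ofReal]
  ring

/-- If `f` takes each value on a null set only, multiplication by `f` has no eigenvector. -/
theorem eq_zero_of_mulL_eq_smul (hfn : ∀ z, μ (f ⁻¹' {z}) = 0) {g : Lp ℂ 2 μ} {z : ℂ}
    (h : mulL hf g = z • g) : g = 0 := by
  rw [eq_zero_iff_ae_eq_zero]
  have h1 : ∀ᵐ x ∂μ, f x ≠ z := by
    rw [ae_iff]
    simpa using! hfn z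
  filter_upwards [h1, coeFn_mulL hf g, coeFn_smul z g] with x hx hx1 hx2
  rw [h, hx2] at hx1
  have h3 : (z - f x) * g x = 0 := by
    rw [sub_mul, ← hx1]
    simp
  exact (mul_eq_zero.mp h3).resolve_left (sub_ne_zero.mpr hx.symm)

end MeasureTheory.Lp

theorem measurable_ofReal_sub_inv (z : ℂ) : Measurable fun t : ℝ => ((t : ℂ) - z)⁻¹ := by
  fun_prop

/-! ### Spectral type of an operator unitarily equivalent to multiplication -/

namespace SA

variable {H : Type*} [NormedAddCommGroup H] [InnerProductSpace ℂ H] [CompleteSpace H]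

section

open MeasureTheory.Lp

variable {α : Type*} [MeasurableSpace α] {μ : Measure α} {f : α → ℝ}
  (hf : MemLp (fun x => (f x : ℂ)) ⊤ μ) (T : H →L[ℂ] H) (hT : IsSelfAdjoint T)
  (U : H ≃ₗᵢ[ℂ] Lp ℂ 2 μ) (hU : ∀ x, U (T x) = mulL hf (U x))

include hU

theorem pointSpectrum_eq_empty_of_mulL (hfn : ∀ t, μ (f ⁻¹' {t}) = 0) :
    (ofBounded T hT).pointSpectrum = ∅ := by
  refine Set.eq_empty_of_forall_notMem fun z ⟨x, hx0, hx⟩ => hx0 ?_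
  have h1 : mulL hf (U x) = z • U x := by
    rw [← hU, ← map_smul, ← hx]
    rfl
  have h2 := eq_zero_of_mulL_eq_smul hf (fun w => ?_) h1
  · exact U.map_eq_zero_iff.mp h2
  -- The candidate eigenvalue is complex, but `f` is real, so its level set lies in that of the real
  -- part.
  · refine measure_mono_null (fun y hy => ?_) (hfn w.re)
    have : (f y : ℂ) = w := hy
    simp [← this]

/-- The resolvent of an operator that is unitarily equivalent to a multiplication operator. -/
theorem resolvent_of_mulL {z : ℂ} (hz : z.im ≠ 0) (ξ : H) :
    U ((ofBounded T hT).resolvent z hz ξ) =ᵐ[μ] fun x => ((f x : ℂ) - z)⁻¹ * U ξ x := by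
  obtain ⟨h, hy⟩ := (ofBounded T hT).shift_resolvent z hz ξ
  rw [shift_ofBounded] at hy
  simp only at hy
  set y := (ofBounded T hT).resolvent z hz ξ
  have h1 : U ξ = mulL hf (U y) - z • U y := by
    rw [← hU, ← map_smul, ← map_sub, hy]
  filter_upwards [coeFn_mulL hf (U y), Lp.coeFn_sub (mulL hf (U y)) (z • U y),
    Lp.coeFn_smul z (U y)] with x hx1 hx2 hx3
  have hne : (f x : ℂ) - z ≠ 0 := fun h0 => hz (by rw [← sub_eq_zero.mp h0, Complex.ofReal_im])
  rw [h1, hx2, Pi.sub_apply, hx1, hx3, Pi.smul_apply, smul_eq_mul, ← sub_mul,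
    inv_mul_cancel_left₀ hne]

theorem isSpectralMeasure_of_mulL (hfm : Measurable f) (ξ : H) :
    (ofBounded T hT).IsSpectralMeasure ξ
      ((μ.withDensity fun x => ‖U ξ x‖ₑ ^ 2).map f) := by
  have hmeas : AEMeasurable (fun x => ‖U ξ x‖ₑ ^ 2) μ :=
    (Lp.aestronglyMeasurable (U ξ)).enorm.pow_const 2
  have hfin : ∫⁻ x, ‖U ξ x‖ₑ ^ 2 ∂μ ≠ ⊤ := by
    have := lintegral_rpow_enorm_lt_top_of_eLpNorm_lt_top two_ne_zero ENNReal.ofNat_ne_top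
      (Lp.memLp (U ξ)).2
    simpa using this.ne
  have hfin' : IsFiniteMeasure (μ.withDensity fun x => ‖U ξ x‖ₑ ^ 2) :=
    isFiniteMeasure_withDensity hfin
  refine ⟨Measure.isFiniteMeasure_map _ _, fun z hz => ?_⟩
  rw [integral_map hfm.aemeasurable (measurable_ofReal_sub_inv z).aestronglyMeasurable,
    integral_withDensity_eq_integral_toReal_smul₀ hmeas
      (Filter.Eventually.of_forall fun x => by simp [ENNReal.pow_lt_top_iff]),
    ← U.inner_map_map, L2.inner_def]
  refine integral_congr_ae ?_
  filter_upwards [resolvent_of_mulL hf T hT U hU hz ξ] with x hx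
  rw [hx, RCLike.inner_apply, ENNReal.toReal_pow, toReal_enorm, Complex.real_smul, mul_assoc,
    Complex.mul_conj, Complex.normSq_eq_norm_sq, mul_comm]

/-- The spectral measure at `ξ` is carried by the null set `N`. If it is also absolutely continuous
it vanishes, and its total mass is `∫ ‖U ξ‖²`, so `ξ = 0`. -/
theorem acSpectrum_eq_empty_of_mulL (hfm : Measurable f) {N : Set ℝ} (hN : MeasurableSet N)
    (hN0 : volume N = 0) (hfN : ∀ x, f x ∈ N) : (ofBounded T hT).acSpectrum = ∅ := by
  refine acSpectrum_eq_empty_of_subset _ fun ξ hξ => ?_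
  have h1 := hξ _ (isSpectralMeasure_of_mulL hf T hT U hU hfm ξ) hN0
  have hpre : f ⁻¹' N = Set.univ := Set.eq_univ_of_forall hfN
  rw [Measure.map_apply hfm hN, hpre, withDensity_apply _ MeasurableSet.univ,
    Measure.restrict_univ, lintegral_eq_zero_iff'
      ((Lp.aestronglyMeasurable (U ξ)).enorm.pow_const 2)] at h1
  refine U.map_eq_zero_iff.mp (Lp.eq_zero_iff_ae_eq_zero.mpr ?_)
  filter_upwards [h1] with x hx
  simpa using hx

end

/-! ### Reduction to finite dimension -/

/-- For `A ∈ SA H` and finitely many vectors, there is a symmetric operator on a finite-dimensional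
subspace whose resolvent at `i` agrees with that of `A` on these vectors. -/
theorem exists_finiteDimensional_isSymmetric (A : SA H) (F : Finset H) :
    ∃ (V : Submodule ℂ H) (_ : FiniteDimensional ℂ V) (L : V →ₗ[ℂ] V), L.IsSymmetric ∧
      ∀ ξ ∈ F, ∃ x : V, (x : H) = A.resolvent Complex.I (by simp) ξ ∧
        (L x : H) - Complex.I • (x : H) = ξ := by
  classical
  let R := A.resolvent Complex.I (by simp)
  let V : Submodule ℂ H := Submodule.span ℂ (F ∪ F.image R : Finset H)
  have hVF : ∀ ξ ∈ F, ξ ∈ V := fun ξ hξ => Submodule.subset_span (by simp [hξ])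
  have hVR : ∀ ξ ∈ F, R ξ ∈ V := fun ξ hξ =>
    Submodule.subset_span (by
      rw [Finset.mem_coe]
      exact Finset.mem_union_right _ (Finset.mem_image_of_mem R hξ))
  have : FiniteDimensional ℂ V := FiniteDimensional.span_finset ℂ _
  let D : Submodule ℂ V := A.op.domain.comap V.subtype
  let T : D →ₗ[ℂ] V := V.orthogonalProjectionOnto.toLinearMap ∘ₗ A.op.toFun ∘ₗ
    (V.subtype.restrict (p := D) (q := A.op.domain) fun x hx => hx)
  have hT : ∀ x : D, T x = V.orthogonalProjectionOnto (A.op ⟨((x : V) : H), x.2⟩) := fun x => rfl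
  obtain ⟨L, hL, hLT⟩ := Submodule.exists_isSymmetric_extension D T fun x y => by
    rw [hT, hT, Submodule.inner_orthogonalProjectionOnto_eq_of_mem_right,
      Submodule.inner_orthogonalProjectionOnto_eq_of_mem_left]
    exact A.isFormalAdjoint ⟨_, x.2⟩ ⟨_, y.2⟩
  refine ⟨V, this, L, hL, fun ξ hξ => ⟨⟨R ξ, hVR ξ hξ⟩, rfl, ?_⟩⟩
  obtain ⟨hd, hs⟩ := A.shift_resolvent Complex.I (by simp) ξ
  have h1 : A.op ⟨R ξ, hd⟩ = ξ + Complex.I • R ξ := by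
    rw [← sub_eq_iff_eq_add]
    exact hs
  have h2 := hLT ⟨⟨R ξ, hVR ξ hξ⟩, hd⟩
  rw [hT] at h2
  -- This is why `V` contains both `ξ` and `R ξ`: the projection onto `V` fixes `A R ξ`.
  have h3 : A.op ⟨R ξ, hd⟩ ∈ V := by
    rw [h1]
    exact V.add_mem (hVF ξ hξ) (V.smul_mem _ (hVR ξ hξ))
  rw [h2]
  rw [Submodule.coe_orthogonalProjectionOnto_apply, Submodule.starProjection_eq_self_iff.mpr h3, h1,
    add_sub_cancel_right]

end SA

/-! ### The singular continuous approximation and the conclusion -/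

/-- The indicator functions of the intervals `[k, k + 1)`, as elements of `L²(ℝ)`. -/
noncomputable def unitIntervalIndicator (k : ℕ) : Lp ℂ 2 (volume : Measure ℝ) :=
  indicatorConstLp 2 (measurableSet_Ico (a := (k : ℝ)) (b := k + 1)) (by simp) 1

theorem orthonormal_unitIntervalIndicator : Orthonormal ℂ unitIntervalIndicator := by
  refine ⟨fun k => ?_, fun k m hkm => ?_⟩
  · rw [unitIntervalIndicator, norm_indicatorConstLp two_ne_zero ENNReal.ofNat_ne_top]
    simp
  · change ⟪indicatorConstLp 2 _ _ 1, unitIntervalIndicator m⟫_ℂ = 0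
    rw [L2.inner_indicatorConstLp_eq_setIntegral_inner]
    refine integral_eq_zero_of_ae ?_
    rw [Filter.EventuallyEq, ae_restrict_iff' measurableSet_Ico]
    filter_upwards [indicatorConstLp_coeFn (p := 2)
      (hs := measurableSet_Ico (a := (m : ℝ)) (b := m + 1)) (hμs := by simp) (c := (1 : ℂ))]
      with x hx hxk
    have hm : unitIntervalIndicator m x = 0 → ⟪(1 : ℂ), unitIntervalIndicator m x⟫_ℂ = 0 :=
      fun h => by rw [h, inner_zero_right]
    refine hm (hx.trans (Set.indicator_of_notMem ?_ _))
    intro hxm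
    refine hkm ?_
    rw [← (Nat.floor_eq_iff ((Nat.cast_nonneg k).trans hxk.1)).mpr hxk,
      ← (Nat.floor_eq_iff ((Nat.cast_nonneg m).trans hxm.1)).mpr hxm]

theorem coeFn_unitIntervalIndicator_floor (l : ℕ → ℂ) (k : ℕ) :
    ∀ᵐ x : ℝ, l ⌊x⌋₊ * unitIntervalIndicator k x = l k * unitIntervalIndicator k x := by
  filter_upwards [indicatorConstLp_coeFn (p := 2)
      (hs := measurableSet_Ico (a := (k : ℝ)) (b := k + 1)) (hμs := by simp) (c := (1 : ℂ))]
    with x hx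
  rw [unitIntervalIndicator, hx]
  by_cases hxk : x ∈ Set.Ico (k : ℝ) (k + 1)
  · rw [(Nat.floor_eq_iff ((Nat.cast_nonneg k).trans hxk.1)).mpr hxk]
  · rw [Set.indicator_of_notMem hxk, mul_zero, mul_zero]

/-- A symmetric operator on a finite-dimensional subspace of an infinite-dimensional separable
Hilbert space is, up to a small error, the restriction of a bounded self-adjoint operator with
purely singular continuous spectrum. -/
theorem LinearMap.IsSymmetric.exists_singularContinuous_approx {H : Type*} [NormedAddCommGroup H]
    [InnerProductSpace ℂ H] [CompleteSpace H] [TopologicalSpace.SeparableSpace H]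
    (hH : ¬ FiniteDimensional ℂ H) {V : Submodule ℂ H} [FiniteDimensional ℂ V] {L : V →ₗ[ℂ] V}
    (hL : L.IsSymmetric) {ε : ℝ} (hε : 0 < ε) :
    ∃ (T : H →L[ℂ] H) (hT : IsSelfAdjoint T), (SA.ofBounded T hT).pointSpectrum = ∅ ∧
      (SA.ofBounded T hT).acSpectrum = ∅ ∧ ∀ x : V, ‖T x - L x‖ ≤ ε * ‖x‖ := by
  let n := Module.finrank ℂ V
  let b : OrthonormalBasis (Fin n) ℂ V := hL.eigenvectorBasis rfl
  -- Only the first `n` values matter on `V`; the padding by `0` keeps the step function bounded.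
  let l : ℕ → ℝ := fun k => if h : k < n then hL.eigenvalues rfl ⟨k, h⟩ else 0
  have hl : ∀ k : Fin n, L (b k) = (l k : ℂ) • b k := fun k => by
    simp only [l, k.2, dif_pos]
    exact hL.apply_eigenvectorBasis rfl k
  obtain ⟨C, hC⟩ : ∃ C, ∀ k, |l k| ≤ C := by
    refine ⟨∑ j : Fin n, |hL.eigenvalues rfl j|, fun k => ?_⟩
    by_cases h : k < n
    · simp only [l, h, dif_pos]
      exact Finset.single_le_sum (f := fun j => |hL.eigenvalues rfl j|)
        (fun _ _ => abs_nonneg _) (Finset.mem_univ _)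
    · simp only [l, h, dif_neg, not_false_eq_true, abs_zero]
      exact Finset.sum_nonneg fun _ _ => abs_nonneg _
  obtain ⟨f, hfm, hfl, hfc, N, hN, hN0, hfN⟩ := exists_singular_step_function l hε
  have hstep : MemLp (fun x : ℝ => ((l ⌊x⌋₊ : ℝ) : ℂ)) ⊤ volume :=
    memLp_top_of_bound (Complex.measurable_ofReal.comp
      ((measurable_from_top (f := l)).comp Nat.measurable_floor)).aestronglyMeasurable C
      (.of_forall fun x => by simpa using hC _)
  have hf : MemLp (fun x : ℝ => (f x : ℂ)) ⊤ volume :=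
    memLp_top_of_bound (Complex.measurable_ofReal.comp hfm).aestronglyMeasurable (C + ε)
      (.of_forall fun x => by
        rw [Complex.norm_real, Real.norm_eq_abs]
        have h1 := abs_add_le (f x - l ⌊x⌋₊) (l ⌊x⌋₊)
        rw [sub_add_cancel] at h1
        linarith [hfl x, hC ⌊x⌋₊])
  have he : Orthonormal ℂ fun k => (b k : H) := b.orthonormal.comp_linearIsometry V.subtypeₗᵢ
  have : Fact ((2 : ENNReal) ≠ ⊤) := ⟨ENNReal.ofNat_ne_top⟩
  obtain ⟨U, hU⟩ := he.exists_linearIsometryEquiv_apply_eq hH orthonormal_unitIntervalIndicator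
  let M := Lp.mulL hf
  let T : H →L[ℂ] H := (U.symm : Lp ℂ 2 volume →L[ℂ] H) ∘L M ∘L (U : H →L[ℂ] Lp ℂ 2 volume)
  have hTU : ∀ x, U (T x) = M (U x) := fun x => U.apply_symm_apply _
  have hT : IsSelfAdjoint T := by
    rw [ContinuousLinearMap.isSelfAdjoint_iff_isSymmetric]
    intro x y
    change ⟪T x, y⟫_ℂ = ⟪x, T y⟫_ℂ
    rw [← U.inner_map_map, ← U.inner_map_map x, hTU, hTU]
    exact (ContinuousLinearMap.isSelfAdjoint_iff_isSymmetric.mp (Lp.isSelfAdjoint_mulL hf)) _ _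
  have hstepU : ∀ x : V, Lp.mulL hstep (U x) = U (L x) := by
    have : (Lp.mulL hstep).toLinearMap ∘ₗ U.toLinearEquiv.toLinearMap ∘ₗ V.subtype =
        U.toLinearEquiv.toLinearMap ∘ₗ V.subtype ∘ₗ L := by
      refine b.toBasis.ext fun k => ?_
      rw [b.coe_toBasis]
      change Lp.mulL hstep (U (b k)) = U (L (b k))
      rw [hl, Submodule.coe_smul, map_smul, hU]
      refine Lp.ext ?_
      filter_upwards [Lp.coeFn_mulL hstep (unitIntervalIndicator k),
        Lp.coeFn_smul (l k : ℂ) (unitIntervalIndicator k),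
        coeFn_unitIntervalIndicator_floor (fun j => l j) k] with x h1 h2 h3
      rw [h1, h2, h3, Pi.smul_apply, smul_eq_mul]
    exact fun x => LinearMap.congr_fun this x
  refine ⟨T, hT, SA.pointSpectrum_eq_empty_of_mulL hf T hT U hTU fun t =>
    (hfc t).measure_zero _, SA.acSpectrum_eq_empty_of_mulL hf T hT U hTU hfm hN hN0 hfN,
    fun x => ?_⟩
  have hx : ‖(x : V)‖ = ‖U x‖ := (U.norm_map x).symm
  rw [hx, ← U.norm_map, map_sub, hTU, ← hstepU]
  refine Lp.norm_le_mul_norm_of_ae_le_mul ?_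
  filter_upwards [Lp.coeFn_sub (M (U x)) (Lp.mulL hstep (U x)), Lp.coeFn_mulL hf (U x),
    Lp.coeFn_mulL hstep (U x)] with y h1 h2 h3
  rw [h1, Pi.sub_apply, h2, h3, ← sub_mul, norm_mul, ← Complex.ofReal_sub, Complex.norm_real]
  exact mul_le_mul_of_nonneg_right (hfl y) (norm_nonneg _)

theorem proposition4p4 (H : Type*) [NormedAddCommGroup H] [InnerProductSpace ℂ H]
    [CompleteSpace H] [TopologicalSpace.SeparableSpace H] (hH : ¬ FiniteDimensional ℂ H) :
    Dense {A : SA H | A.pointSpectrum = ∅ ∧ A.acSpectrum = ∅} := by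
  intro A
  refine A.mem_closure_of_resolvent_approx _ fun F ε hε => ?_
  obtain ⟨V, _, L, hL, hLF⟩ := A.exists_finiteDimensional_isSymmetric F
  let R := A.resolvent Complex.I (by simp)
  let S : ℝ := ∑ ξ ∈ F, ‖R ξ‖
  have hS : 0 ≤ S := Finset.sum_nonneg fun _ _ => norm_nonneg _
  -- `S` bounds every `‖R ξ‖`; the `+ 1` avoids division by zero and makes the final inequality
  -- strict.
  obtain ⟨T, hT, hp, hac, hTL⟩ := hL.exists_singularContinuous_approx hH
    (ε := ε / (S + 1)) (by positivity)
  refine ⟨SA.ofBounded T hT, ⟨hp, hac⟩, fun ξ hξ => ?_⟩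
  obtain ⟨x, hxR, hx⟩ := hLF ξ hξ
  have hI : Complex.I.im ≠ 0 := by simp
  have hxS : ‖x‖ ≤ S := by
    have := Finset.single_le_sum (f := fun ξ => ‖R ξ‖) (fun _ _ => norm_nonneg _) hξ
    rwa [← hxR] at this
  -- Second resolvent identity at `x = R ξ`: `ξ = (L - i) x`, while `x = (T - i)⁻¹ (T - i) x`.
  have h1 : (SA.ofBounded T hT).resolvent Complex.I hI ξ - A.resolvent Complex.I hI ξ =
      (SA.ofBounded T hT).resolvent Complex.I hI (-(T x - L x)) := by
    rw [← hxR, ← SA.resolvent_ofBounded T hT hI x, ← map_sub]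
    congr 1
    rw [SA.resolvent_ofBounded T hT hI x, ← hx]
    abel
  rw [h1]
  calc _ ≤ |Complex.I.im|⁻¹ * ‖-(T x - L x)‖ := SA.norm_resolvent_le _ hI _
    _ = ‖T x - L x‖ := by rw [_root_.norm_neg, Complex.I_im, abs_one, inv_one, one_mul]
    _ ≤ ε / (S + 1) * ‖x‖ := hTL x
    _ ≤ ε / (S + 1) * S := by gcongr
    _ < ε := by
      rw [div_mul_eq_mul_div, div_lt_iff₀ (by positivity)]
      nlinarith
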